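/- Let $\Sigma$ be a compact (connected) Riemann surface, $A\subset\Sigma$ a finite subset, and $L$ a theta characteristic, i.e. a holomorphic line bundle with $L^{\otimes 2}=\mathcal K$, the canonical bundle. For $\lambda\in\frac12\mathbb Z$ let $\mathcal F^\lambda$ be the space of global meromorphic sections of $L^{\otimes 2\lambda}$ that are holomorphic on $\Sigma\setminus A$; locally they are written $f(z)\,(dz)^\lambda$. Let $\mathcal L=\mathcal F^{-1}$ and let $\mathcal S=\mathcal L\oplus\mathcal F^{-1/2}$ (even part $\mathcal L$, odd part $\mathcal F^{-1/2}$) be the Krichever-Novikov Lie superalgebra, with bracket given in a local coordinate by $$[e,f]=ef'-e'f,\qquad [e,\varphi]=-[\varphi,e]=e\varphi'-\tfrac12\,\varphi e',\qquad [\varphi,\psi]=\varphi\psi$$ for $e,f\in\mathcal L$ and $\varphi,\psi\in\mathcal F^{-1/2}$. A holomorphic projective connection $R$ is a system of holomorphic functions $R_\alpha(z_\alpha)$, one for each coordinate $z_\alpha$ of a covering by holomorphic coordinates, such that $R_\beta(z_\beta)\,(h')^2=R_\alpha(z_\alpha)+S(h)$ whenever $z_\beta=h(z_\alpha)$, where $S(h)=\frac{h'''}{h'}-\frac32\left(\frac{h''}{h'}\right)^2$.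 For a closed $C^1$ curve $C$ (finitely many closed loops) not meeting $A$ write $\oint_C=\frac1{24\pi\mathrm i}\int_C$, and let $\Phi_{C,R}$ be the bilinear form on $\mathcal S$ with $$\Phi_{C,R}(e,f)=\oint_C\left(\tfrac12(e'''f-ef''')-R\,(e'f-ef')\right)dz,$$ $$\Phi_{C,R}(\varphi,\psi)=-\oint_C\left(\varphi''\psi+\varphi\psi''-R\,\varphi\psi\right)dz,\qquad \Phi_{C,R}(e,\varphi)=\Phi_{C,R}(\varphi,e)=0.$$ An even super-cocycle is a bilinear form $c:\mathcal S\times\mathcal S\to\mathbb C$ that vanishes on pairs of elements of different parity and satisfies, for homogeneous $x,y,z$ of parities $\bar x,\bar y,\bar z$, $$c(x,y)=-(-1)^{\bar x\bar y}c(y,x),\qquad (-1)^{\bar x\bar z}c(x,[y,z])+(-1)^{\bar y\bar x}c(y,[z,x])+(-1)^{\bar z\bar y}c(z,[x,y])=0.$$ An even coboundary is a form $\delta_1\kappa(x,y)=\kappa([x,y])$ with $\kappa:\mathcal S\to\mathbb C$ linear and zero on the odd part, and $H^2_{\bar 0}(\mathcal S,\mathbb C)$ is the space of even super-cocycles modulo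 the even coboundaries. **Proposition.** Let $R$ and $R'$ be two holomorphic projective connections. Then $\Phi_{C,R}$ and $\Phi_{C,R'}$ are even super-cocycles, the map $$\kappa_C:\mathcal S\to\mathbb C,\qquad \kappa_C(e,\varphi)=\oint_C (R'-R)\cdot e\,dz$$ is a linear form (zero on the odd part), and $$\Phi_{C,R'}-\Phi_{C,R}=\delta_1\kappa_C .$$ Hence $\Phi_{C,R}$ and $\Phi_{C,R'}$ are cohomologous: their classes in $H^2_{\bar 0}(\mathcal S,\mathbb C)$ are equal, so the class does not depend on the choice of $R$. -/

import Mathlib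

open scoped Manifold ContDiff

namespace KN

/-- A covering of the Riemann surface `X` by holomorphic coordinates `z_i` (`i : ι`): charts of the
maximal holomorphic atlas whose domains cover `X`. -/
structure CoordinateCover (X : Type*) [TopologicalSpace X] [ChartedSpace ℂ X] (ι : Type*) where
  chart : ι → OpenPartialHomeomorph X ℂ
  mem_maximalAtlas : ∀ i, chart i ∈ IsManifold.maximalAtlas 𝓘(ℂ) ω X
  exists_mem_source : ∀ x : X, ∃ i, x ∈ (chart i).source

namespace CoordinateCover

variable {X : Type*} [TopologicalSpace X] [ChartedSpace ℂ X] {ι : Type*}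

/-- The coordinate change `z_j = h_{ji}(z_i)`. -/
noncomputable def trans (U : CoordinateCover X ι) (i j : ι) (z : ℂ) : ℂ :=
  U.chart j ((U.chart i).symm z)

/-- The overlap of the domains of `z_i` and `z_j`, seen in the coordinate `z_i`: the domain of
`h_{ji}`. -/
def overlap (U : CoordinateCover X ι) (i j : ι) : Set ℂ :=
  {z | z ∈ (U.chart i).target ∧ (U.chart i).symm z ∈ (U.chart j).source}

/-- The part of the domain of `z_i` outside of the finite set `A`, seen in the coordinate `z_i`. -/
def dom (U : CoordinateCover X ι) (A : Finset X) (i : ι) : Set ℂ :=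
  {z | z ∈ (U.chart i).target ∧ (U.chart i).symm z ∉ A}

/-- Some index `i` for which `x` lies in the domain of `z_i`. -/
noncomputable def index (U : CoordinateCover X ι) (x : X) : ι :=
  (U.exists_mem_source x).choose

theorem isOpen_overlap (U : CoordinateCover X ι) (i j : ι) : IsOpen (U.overlap i j) :=
  (U.chart i).isOpen_inter_preimage_symm (U.chart j).open_source

theorem isOpen_dom [T1Space X] (U : CoordinateCover X ι) (A : Finset X) (i : ι) :
    IsOpen (U.dom A i) :=
  (U.chart i).isOpen_inter_preimage_symm A.finite_toSet.isClosed.isOpen_compl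

theorem differentiableAt_trans (U : CoordinateCover X ι) {i j : ι} {z : ℂ}
    (hz : z ∈ U.overlap i j) : DifferentiableAt ℂ (U.trans i j) z := by
  have h := IsManifold.compatible_of_mem_maximalAtlas (U.mem_maximalAtlas i)
    (U.mem_maximalAtlas j)
  rw [contDiffGroupoid, mem_groupoid_of_pregroupoid] at h
  have h1 : ContDiffOn ℂ ω (U.trans i j) (U.overlap i j) := by
    have h2 := h.1
    simp only [contDiffPregroupoid, OpenPartialHomeomorph.trans_source] at h2
    have h3 : ContDiffOn ℂ ω (U.chart j ∘ (U.chart i).symm)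
        ((U.chart i).target ∩ (U.chart i).symm ⁻¹' (U.chart j).source) := by simpa using h2
    exact h3
  exact (h1.contDiffAt ((U.isOpen_overlap i j).mem_nhds hz)).differentiableAt (by simp)

end CoordinateCover

/-- A theta characteristic: a holomorphic line bundle `L` with `L ⊗ L = K` (the canonical bundle),
given by transition functions for local frames `(dz_i)^{1/2}` of `L` whose squares are the frames
`dz_i` of `K`. Here `(dz_j)^{1/2} = root i j · (dz_i)^{1/2}`; the function `root i j` is written
in the coordinate `z_i`, is relevant only on the overlap, and satisfies
`(root i j)^2 = dz_j / dz_i` together with the cocycle condition. -/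
structure ThetaCharacteristic {X : Type*} [TopologicalSpace X] [ChartedSpace ℂ X] {ι : Type*}
    (U : CoordinateCover X ι) where
  root : ι → ι → ℂ → ℂ
  analyticOnNhd : ∀ i j, AnalyticOnNhd ℂ (root i j) (U.overlap i j)
  root_ne_zero : ∀ i j, ∀ z ∈ U.overlap i j, root i j z ≠ 0
  sq_eq : ∀ i j, ∀ z ∈ U.overlap i j, root i j z ^ 2 = deriv (U.trans i j) z
  cocycle : ∀ i j k, ∀ z ∈ U.overlap i j ∩ U.overlap i k,
    root i k z = root j k (U.trans i j z) * root i j z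

section Forms

variable {X : Type*} [TopologicalSpace X] [T1Space X] [ChartedSpace ℂ X] {ι : Type*}
  {U : CoordinateCover X ι}

/-- The space `F^λ` with `λ = k / 2`: global meromorphic sections of `L^{⊗ k}` which are
holomorphic outside of `A`. A section is the family of its local representatives `f_i`, the section
being `f_i (dz_i)^{k/2}`, as functions of the coordinate `z_i`. To make the representatives unique,
they are given the value zero off the coordinate domain and at the points of `A`; a condition of
meromorphy does not see these values. -/
def forms (L : ThetaCharacteristic U) (A : Finset X) (k : ℤ) : Submodule ℂ (ι → ℂ → ℂ) where
  carrier := {f |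
    (∀ i, ∀ z ∉ U.dom A i, f i z = 0) ∧
    (∀ i, ∀ z ∈ U.dom A i, AnalyticAt ℂ (f i) z) ∧
    (∀ i, ∀ z ∈ (U.chart i).target, MeromorphicAt (f i) z) ∧
    (∀ i j, ∀ z ∈ U.dom A i ∩ U.overlap i j,
      f j (U.trans i j z) * L.root i j z ^ k = f i z)}
  zero_mem' := by
    refine ⟨fun _ _ _ => rfl, fun _ _ _ => analyticAt_const, fun _ _ _ =>
      MeromorphicAt.const 0 _, fun _ _ _ _ => by simp⟩
  add_mem' := by
    rintro f g ⟨f1, f2, f3, f4⟩ ⟨g1, g2, g3, g4⟩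
    refine ⟨fun i z hz => by simp [f1 i z hz, g1 i z hz],
      fun i z hz => (f2 i z hz).add (g2 i z hz), fun i z hz => (f3 i z hz).add (g3 i z hz),
      fun i j z hz => ?_⟩
    simp only [Pi.add_apply]
    rw [← f4 i j z hz, ← g4 i j z hz]
    ring
  smul_mem' := by
    rintro c f ⟨f1, f2, f3, f4⟩
    refine ⟨fun i z hz => by simp [f1 i z hz],
      fun i z hz => analyticAt_const.mul (f2 i z hz),
      fun i z hz => (MeromorphicAt.const c z).mul (f3 i z hz),
      fun i j z hz => ?_⟩
    simp only [Pi.smul_apply, smul_eq_mul]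
    rw [← f4 i j z hz]
    ring

/-- The product `F^{k/2} × F^{l/2} → F^{(k+l)/2}`, locally `(s, t) ↦ s t`. -/
def mulForm {L : ThetaCharacteristic U} {A : Finset X} {k l m : ℤ} (hm : k + l = m)
    (s : forms L A k) (t : forms L A l) : forms L A m :=
  ⟨fun i z => s.1 i z * t.1 i z, by
    obtain ⟨s, s1, s2, s3, s4⟩ := s
    obtain ⟨t, t1, t2, t3, t4⟩ := t
    refine ⟨fun i z hz => by simp [s1 i z hz], fun i z hz => (s2 i z hz).mul (t2 i z hz),
      fun i z hz => (s3 i z hz).mul (t3 i z hz), fun i j z hz => ?_⟩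
    simp only
    rw [← s4 i j z hz, ← t4 i j z hz, ← hm, zpow_add₀ (L.root_ne_zero i j z hz.2)]
    ring⟩

theorem deriv_forms {L : ThetaCharacteristic U} {A : Finset X} {k : ℤ}
    (f : forms L A k) {i j : ι} {z : ℂ} (hz : z ∈ U.dom A i ∩ U.overlap i j) :
    deriv (f.1 i) z = deriv (f.1 j) (U.trans i j z) * L.root i j z ^ (k + 2) +
      f.1 j (U.trans i j z) * (k * L.root i j z ^ (k - 1) * deriv (L.root i j) z) := by
  have hr := L.root_ne_zero i j z hz.2
  have hmem : U.trans i j z ∈ U.dom A j := by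
    refine ⟨(U.chart j).map_source hz.2.2, ?_⟩
    rw [CoordinateCover.trans, (U.chart j).left_inv hz.2.2]
    exact hz.1.2
  have hev : f.1 i =ᶠ[nhds z] fun w => f.1 j (U.trans i j w) * L.root i j w ^ k := by
    filter_upwards [((U.isOpen_dom A i).inter (U.isOpen_overlap i j)).mem_nhds hz] with w hw
    exact (f.2.2.2.2 i j w hw).symm
  have h1 : HasDerivAt (fun w => f.1 j (U.trans i j w))
      (deriv (f.1 j) (U.trans i j z) * deriv (U.trans i j) z) z :=
    ((f.2.2.1 j _ hmem).differentiableAt.hasDerivAt).comp z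
      (U.differentiableAt_trans hz.2).hasDerivAt
  have h2 : HasDerivAt (fun w => L.root i j w ^ k)
      (k * L.root i j z ^ (k - 1) * deriv (L.root i j) z) z :=
    (hasDerivAt_zpow k _ (Or.inl hr)).comp z
      (L.analyticOnNhd i j z hz.2).differentiableAt.hasDerivAt
  have h3 := (h1.mul h2).deriv
  rw [hev.deriv_eq]
  refine h3.trans ?_
  rw [← L.sq_eq i j z hz.2, zpow_add₀ hr]
  norm_cast
  ring

/-- The Lie derivative `F^{-1} × F^{λ} → F^{λ}`, locally `e . f = e f' + λ f e'`, where
`λ = k / 2`. For `k = -2` it is the Lie bracket `[e, f]` of vector fields. -/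
noncomputable def lieDer {L : ThetaCharacteristic U} {A : Finset X} {k : ℤ}
    (e : forms L A (-2)) (f : forms L A k) : forms L A k :=
  ⟨fun i z => e.1 i z * deriv (f.1 i) z + (k / 2 : ℂ) * f.1 i z * deriv (e.1 i) z, by
    refine ⟨fun i z hz => by simp [e.2.1 i z hz, f.2.1 i z hz],
      fun i z hz => ?_, fun i z hz => ?_, fun i j z hz => ?_⟩
    · exact ((e.2.2.1 i z hz).mul (f.2.2.1 i z hz).deriv).add
        ((analyticAt_const.mul (f.2.2.1 i z hz)).mul (e.2.2.1 i z hz).deriv)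
    · exact ((e.2.2.2.1 i z hz).mul (f.2.2.2.1 i z hz).deriv).add
        (((MeromorphicAt.const _ z).mul (f.2.2.2.1 i z hz)).mul (e.2.2.2.1 i z hz).deriv)
    · have hr := L.root_ne_zero i j z hz.2
      simp only
      rw [deriv_forms e hz, deriv_forms f hz, ← e.2.2.2.2 i j z hz,
        ← f.2.2.2.2 i j z hz, zpow_add₀ hr, zpow_sub_one₀ hr]
      have h2 : L.root i j z ^ (-2 : ℤ) = (L.root i j z)⁻¹ ^ 2 := by
        rw [zpow_neg]; norm_cast; rw [inv_pow]
      have h3 : L.root i j z ^ (-2 - 1 : ℤ) = (L.root i j z)⁻¹ ^ 3 := by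
        rw [show (-2 - 1 : ℤ) = -(3 : ℕ) by norm_num, zpow_neg, zpow_natCast, inv_pow]
      rw [h2, h3]
      have h4 : L.root i j z ^ (2 : ℤ) = L.root i j z ^ 2 := by norm_cast
      have h5 : L.root i j z ^ (-2 + 2 : ℤ) = 1 := by norm_num
      rw [h4, h5]
      push_cast
      field_simp
      ring⟩

/-- The Krichever-Novikov Lie superalgebra `S = F^{-1} ⊕ F^{-1/2}` as a vector space; the even
part `F^{-1}` consists of the vector fields, the odd part `F^{-1/2}` of the `-1/2`-forms. -/
abbrev Super (L : ThetaCharacteristic U) (A : Finset X) : Type _ :=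
  forms L A (-2) × forms L A (-1)

/-- The superbracket, bilinear with `[e, f]` the bracket of vector fields, `[e, φ] = e . φ`,
`[φ, e] = - e . φ` and `[φ, ψ] = φ · ψ`. -/
noncomputable def superBracket {L : ThetaCharacteristic U} {A : Finset X} (x y : Super L A) :
    Super L A :=
  (lieDer x.1 y.1 + mulForm (by norm_num) x.2 y.2, lieDer x.1 y.2 - lieDer y.1 x.2)

/-- `x` is homogeneous of parity `p`. -/
def HasParity {L : ThetaCharacteristic U} {A : Finset X} (p : Fin 2) (x : Super L A) : Prop :=
  if p = 0 then x.2 = 0 else x.1 = 0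

/-- The sign `(-1)^{p q}`. -/
def sgn (p q : Fin 2) : ℂ := (-1) ^ (p.val * q.val)

/-- The space of even super-2-cocycles of `S` with values in `ℂ`: the bilinear, even,
super-antisymmetric maps which satisfy the super-cocycle condition. -/
noncomputable def evenCocycles (L : ThetaCharacteristic U) (A : Finset X) :
    Submodule ℂ (Super L A → Super L A → ℂ) where
  carrier := {c |
    (∀ x, IsLinearMap ℂ (fun y => c x y)) ∧
    (∀ y, IsLinearMap ℂ (fun x => c x y)) ∧
    (∀ x y, HasParity 0 x → HasParity 1 y → c x y = 0 ∧ c y x = 0) ∧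
    (∀ p q x y, HasParity p x → HasParity q y → c x y = -sgn p q * c y x) ∧
    (∀ p q r x y z, HasParity p x → HasParity q y → HasParity r z →
      sgn p r * c x (superBracket y z) + sgn q p * c y (superBracket z x) +
        sgn r q * c z (superBracket x y) = 0)}
  zero_mem' := by
    refine ⟨fun _ => ⟨by simp, by simp⟩, fun _ => ⟨by simp, by simp⟩, by simp, by simp, by simp⟩
  add_mem' := by
    rintro c d ⟨c1, c2, c3, c4, c5⟩ ⟨d1, d2, d3, d4, d5⟩
    refine ⟨fun x => ⟨fun y z => ?_, fun a y => ?_⟩, fun x => ⟨fun y z => ?_, fun a y => ?_⟩,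
      fun x y hx hy => ?_, fun p q x y hx hy => ?_, fun p q r x y z hx hy hz => ?_⟩
    · have h1 := (c1 x).map_add y z
      have h2 := (d1 x).map_add y z
      simp only [Pi.add_apply] at *
      rw [h1, h2]; ring
    · have h1 := (c1 x).map_smul a y
      have h2 := (d1 x).map_smul a y
      simp only [Pi.add_apply, smul_eq_mul] at *
      rw [h1, h2]; ring
    · have h1 := (c2 x).map_add y z
      have h2 := (d2 x).map_add y z
      simp only [Pi.add_apply] at *
      rw [h1, h2]; ring
    · have h1 := (c2 x).map_smul a y
      have h2 := (d2 x).map_smul a y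
      simp only [Pi.add_apply, smul_eq_mul] at *
      rw [h1, h2]; ring
    · simp [c3 x y hx hy, d3 x y hx hy]
    · simp only [Pi.add_apply]
      rw [c4 p q x y hx hy, d4 p q x y hx hy]; ring
    · simp only [Pi.add_apply]
      linear_combination c5 p q r x y z hx hy hz + d5 p q r x y z hx hy hz
  smul_mem' := by
    rintro b c ⟨c1, c2, c3, c4, c5⟩
    refine ⟨fun x => ⟨fun y z => ?_, fun a y => ?_⟩, fun x => ⟨fun y z => ?_, fun a y => ?_⟩,
      fun x y hx hy => ?_, fun p q x y hx hy => ?_, fun p q r x y z hx hy hz => ?_⟩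
    · have h1 := (c1 x).map_add y z
      simp only [Pi.smul_apply, smul_eq_mul] at *
      rw [h1]; ring
    · have h1 := (c1 x).map_smul a y
      simp only [Pi.smul_apply, smul_eq_mul] at *
      rw [h1]; ring
    · have h1 := (c2 x).map_add y z
      simp only [Pi.smul_apply, smul_eq_mul] at *
      rw [h1]; ring
    · have h1 := (c2 x).map_smul a y
      simp only [Pi.smul_apply, smul_eq_mul] at *
      rw [h1]; ring
    · simp [c3 x y hx hy]
    · simp only [Pi.smul_apply, smul_eq_mul]
      rw [c4 p q x y hx hy]; ring
    · simp only [Pi.smul_apply, smul_eq_mul]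
      linear_combination b * c5 p q r x y z hx hy hz

/-- The coboundary `δ₁ κ (x, y) = κ([x, y])` of a linear form `κ`. -/
noncomputable def coboundary {L : ThetaCharacteristic U} {A : Finset X}
    (κ : Super L A →ₗ[ℂ] ℂ) : Super L A → Super L A → ℂ :=
  fun x y => κ (superBracket x y)

/-- The even coboundaries: coboundaries of the linear forms that vanish on the odd part. -/
noncomputable def evenCoboundaries (L : ThetaCharacteristic U) (A : Finset X) :
    Submodule ℂ (Super L A → Super L A → ℂ) where
  carrier := {c | ∃ κ : Super L A →ₗ[ℂ] ℂ, (∀ φ, κ (0, φ) = 0) ∧ c = coboundary κ}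
  zero_mem' := ⟨0, by simp, rfl⟩
  add_mem' := by
    rintro _ _ ⟨κ, h, rfl⟩ ⟨κ', h', rfl⟩
    exact ⟨κ + κ', fun φ => by simp [h, h'], rfl⟩
  smul_mem' := by
    rintro a _ ⟨κ, h, rfl⟩
    exact ⟨a • κ, fun φ => by simp [h], rfl⟩

/-- The even part of the second cohomology `H²(S, ℂ)`: even cocycles modulo even coboundaries. -/
abbrev EvenH2 (L : ThetaCharacteristic U) (A : Finset X) : Type _ :=
  evenCocycles L A ⧸ (evenCoboundaries L A).submoduleOf (evenCocycles L A)

end Forms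

/-- The Schwarzian derivative. -/
noncomputable def schwarzian (h : ℂ → ℂ) (z : ℂ) : ℂ :=
  iteratedDeriv 3 h z / deriv h z - 3 / 2 * (iteratedDeriv 2 h z / deriv h z) ^ 2

/-- A holomorphic projective connection, given by its local functions `R_i` in the coordinates
`z_i`. -/
structure ProjectiveConnection {X : Type*} [TopologicalSpace X] [ChartedSpace ℂ X] {ι : Type*}
    (U : CoordinateCover X ι) where
  toFun : ι → ℂ → ℂ
  analyticOnNhd : ∀ i, AnalyticOnNhd ℂ (toFun i) (U.chart i).target
  transform : ∀ i j, ∀ z ∈ U.overlap i j,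
    toFun j (U.trans i j z) * deriv (U.trans i j) z ^ 2 =
      toFun i z + schwarzian (U.trans i j) z

/-- A closed differentiable curve on `X`, not necessarily connected and not meeting `A`: finitely
many closed `C¹` loops, parametrised by `[0, 1]`. -/
structure ClosedCurve {X : Type*} [TopologicalSpace X] [ChartedSpace ℂ X] (A : Finset X) where
  num : ℕ
  path : Fin num → ℝ → X
  contMDiffOn : ∀ k, ContMDiffOn 𝓘(ℝ, ℝ) 𝓘(ℝ, ℂ) 1 (path k) (Set.Icc 0 1)
  closed : ∀ k, path k 0 = path k 1
  avoids : ∀ k, ∀ t ∈ Set.Icc (0 : ℝ) 1, path k t ∉ A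

section Integration

variable {X : Type*} [TopologicalSpace X] [ChartedSpace ℂ X] {ι : Type*}
  {A : Finset X}

/-- The normalised integral `(1 / 24πi) ∫_C w` of the differential that is `w_i dz_i` in the
coordinate `z_i`. The integrand at time `t` is computed in some coordinate around the point of the
curve; for a differential the result does not depend on that coordinate. -/
noncomputable def cint (U : CoordinateCover X ι) (C : ClosedCurve A) (w : ι → ℂ → ℂ) : ℂ :=
  1 / (24 * Real.pi * Complex.I) * ∑ k, ∫ t in (0 : ℝ)..1,
    w (U.index (C.path k t)) (U.chart (U.index (C.path k t)) (C.path k t)) *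
      deriv (fun s : ℝ => U.chart (U.index (C.path k t)) (C.path k s)) t

/-- The bilinear form `Φ_{C,R}` on `S`: on vector fields the integral of
`1/2 (e''' f - e f''') - R (e' f - e f')`, on `-1/2`-forms minus the integral of
`φ'' ψ + φ ψ'' - R φ ψ`, and zero on mixed pairs. -/
noncomputable def superCocycle [T1Space X] {U : CoordinateCover X ι}
    {L : ThetaCharacteristic U} (C : ClosedCurve A)
    (R : ProjectiveConnection U) (x y : Super L A) : ℂ :=
  cint U C (fun i z =>
    1 / 2 * (iteratedDeriv 3 (x.1.1 i) z * y.1.1 i z - x.1.1 i z * iteratedDeriv 3 (y.1.1 i) z)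
      - R.toFun i z * (deriv (x.1.1 i) z * y.1.1 i z - x.1.1 i z * deriv (y.1.1 i) z)) -
  cint U C (fun i z =>
    iteratedDeriv 2 (x.2.1 i) z * y.2.1 i z + x.2.1 i z * iteratedDeriv 2 (y.2.1 i) z
      - R.toFun i z * x.2.1 i z * y.2.1 i z)

end Integration

end KN

/-! ### Differentials off `A` -/

namespace KN

/-! Everything rests on two facts about differentials holomorphic off `A`: their integral along the
curve may be computed in any coordinate, which makes it additive, and the integral of an exact one
over a closed curve is zero (`cint_exact`).

The densities of `Φ` are such differentials. Write a coordinate change `h` as `h' = u⁻²`, where `u`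
is the transition factor of `-1/2`-forms. Then `S(h) = -2u''/u`, so `R_i = R_j u⁻⁴ + 2u''/u`, and
this inhomogeneous term absorbs exactly the failure of `1/2 (e'''f - ef''')` and of `φ''ψ + φψ''` to
be differentials (`isDifferential_evenDensity`, `isDifferential_oddDensity`).

By parity the cocycle condition has content only for three even arguments or for one even and two
odd ones. In both cases the terms with `R` cancel pointwise, and the rest is `dF` for a trilinear
differential expression `F` of weight zero, hence a function on the surface minus `A`; for three
vector fields `F` is `-1/2` times their Wronskian (`cint_evenDensity_jacobi`, `cint_mixed_jacobi`).

In `Φ_{C,R'} - Φ_{C,R}` the terms without a connection cancel, leaving the integral of `(R' - R)(ef'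
- e'f + φψ)`. This is the quadratic differential `R' - R` paired with the even part of the
superbracket, so the difference is a coboundary (`superCocycle_sub`). -/

/-- A differential holomorphic off `A`, except that only continuity of its local
representatives is demanded: the family `w` represents the differential `w_i dz_i`. -/
structure IsDifferential {X : Type*} [TopologicalSpace X] [ChartedSpace ℂ X] {ι : Type*}
    (U : CoordinateCover X ι) (A : Finset X) (w : ι → ℂ → ℂ) : Prop where
  continuousOn : ∀ i, ContinuousOn (w i) (U.dom A i)
  transform : ∀ i j, ∀ z ∈ U.dom A i ∩ U.overlap i j,
    w j (U.trans i j z) * deriv (U.trans i j) z = w i z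

namespace IsDifferential

variable {X : Type*} [TopologicalSpace X] [ChartedSpace ℂ X] {ι : Type*}
  {U : CoordinateCover X ι} {A : Finset X} {w v : ι → ℂ → ℂ}

theorem add (hw : IsDifferential U A w) (hv : IsDifferential U A v) :
    IsDifferential U A (fun i z => w i z + v i z) :=
  ⟨fun i => (hw.continuousOn i).add (hv.continuousOn i), fun i j z hz => by
    rw [← hw.transform i j z hz, ← hv.transform i j z hz, add_mul]⟩

theorem const_mul (a : ℂ) (hw : IsDifferential U A w) :
    IsDifferential U A (fun i z => a * w i z) :=
  ⟨fun i => continuousOn_const.mul (hw.continuousOn i), fun i j z hz => by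
    rw [← hw.transform i j z hz, mul_assoc]⟩

end IsDifferential

/-! ### Integration along closed curves -/

section Curves

variable {X : Type*} [TopologicalSpace X] [ChartedSpace ℂ X] {ι : Type*}
  {U : CoordinateCover X ι} {A : Finset X}

theorem CoordinateCover.index_mem (U : CoordinateCover X ι) (x : X) :
    x ∈ (U.chart (U.index x)).source :=
  (U.exists_mem_source x).choose_spec

theorem ClosedCurve.mem_dom (C : ClosedCurve A) {i : ι} {k : Fin C.num} {t : ℝ}
    (ht : t ∈ Set.Icc (0 : ℝ) 1) (hi : C.path k t ∈ (U.chart i).source) :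
    U.chart i (C.path k t) ∈ U.dom A i :=
  ⟨(U.chart i).map_source hi, by rw [(U.chart i).left_inv hi]; exact C.avoids k t ht⟩

theorem CoordinateCover.mem_overlap (U : CoordinateCover X ι) {i j : ι} {x : X}
    (hi : x ∈ (U.chart i).source) (hj : x ∈ (U.chart j).source) :
    U.chart i x ∈ U.overlap i j :=
  ⟨(U.chart i).map_source hi, by rwa [(U.chart i).left_inv hi]⟩

theorem CoordinateCover.trans_chart (U : CoordinateCover X ι) {i : ι} (j : ι) {x : X}
    (hi : x ∈ (U.chart i).source) : U.trans i j (U.chart i x) = U.chart j x := by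
  rw [CoordinateCover.trans, (U.chart i).left_inv hi]

theorem ClosedCurve.eventually_mem_source (C : ClosedCurve A) (i : ι) {k : Fin C.num} {t : ℝ}
    (ht : t ∈ Set.Icc (0 : ℝ) 1) (hi : C.path k t ∈ (U.chart i).source) :
    ∀ᶠ s in nhdsWithin t (Set.Icc 0 1), C.path k s ∈ (U.chart i).source :=
  (C.contMDiffOn k).continuousOn t ht ((U.chart i).open_source.mem_nhds hi)

/-- Smoothness of the path is given in the preferred chart at its point; composing with the analytic
change to `z_i` carries it over to any coordinate of the cover. -/
theorem ClosedCurve.contDiffWithinAt_chart [IsManifold 𝓘(ℂ) ω X] (C : ClosedCurve A) (i : ι)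
    {k : Fin C.num} {t : ℝ} (ht : t ∈ Set.Icc (0 : ℝ) 1)
    (hi : C.path k t ∈ (U.chart i).source) :
    ContDiffWithinAt ℝ 1 (fun s => U.chart i (C.path k s)) (Set.Icc 0 1) t := by
  set c := chartAt ℂ (C.path k t) with hc
  have hcm : c ∈ IsManifold.maximalAtlas 𝓘(ℂ) ω X := IsManifold.chart_mem_maximalAtlas _
  have hcs : C.path k t ∈ c.source := mem_chart_source ℂ _
  have h0 := contMDiffWithinAt_iff.1 (C.contMDiffOn k t ht)
  have h1 : ContDiffWithinAt ℝ 1 (fun s => c (C.path k s)) (Set.Icc 0 1) t := by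
    simpa [Function.comp_def, chartAt_self_eq] using h0.2
  have h := IsManifold.compatible_of_mem_maximalAtlas hcm (U.mem_maximalAtlas i)
  rw [contDiffGroupoid, mem_groupoid_of_pregroupoid] at h
  have h2 : ContDiffOn ℂ ω (U.chart i ∘ c.symm)
      (c.target ∩ c.symm ⁻¹' (U.chart i).source) := by
    simpa [contDiffPregroupoid, OpenPartialHomeomorph.trans_source] using h.1
  have h3 : ContDiffAt ℂ 1 (U.chart i ∘ c.symm) (c (C.path k t)) := by
    refine (h2.contDiffAt ((c.isOpen_inter_preimage_symm (U.chart i).open_source).mem_nhds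
      ⟨c.map_source hcs, ?_⟩)).of_le (by exact le_top)
    simpa [c.left_inv hcs] using hi
  refine ((h3.restrict_scalars ℝ).comp_contDiffWithinAt t h1).congr_of_eventuallyEq ?_ ?_
  · filter_upwards [h0.1 (c.open_source.mem_nhds hcs)] with s hs
    simp only [Function.comp_apply]
    rw [c.left_inv hs]
  · simp only [Function.comp_apply]
    rw [c.left_inv hcs]

theorem ClosedCurve.hasDerivWithinAt_chart [IsManifold 𝓘(ℂ) ω X] (C : ClosedCurve A) (i : ι)
    {k : Fin C.num} {t : ℝ} (ht : t ∈ Set.Icc (0 : ℝ) 1)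
    (hi : C.path k t ∈ (U.chart i).source) :
    HasDerivWithinAt (fun s => U.chart i (C.path k s))
      (derivWithin (fun s => U.chart i (C.path k s)) (Set.Icc 0 1) t) (Set.Icc 0 1) t :=
  ((C.contDiffWithinAt_chart i ht hi).differentiableWithinAt one_ne_zero).hasDerivWithinAt

/-- The integrand of `cint` along the `k`-th loop, with one-sided derivatives at the ends. -/
noncomputable def pullback (U : CoordinateCover X ι) (C : ClosedCurve A) (w : ι → ℂ → ℂ)
    (k : Fin C.num) (t : ℝ) : ℂ :=
  w (U.index (C.path k t)) (U.chart (U.index (C.path k t)) (C.path k t)) *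
    derivWithin (fun s => U.chart (U.index (C.path k t)) (C.path k s)) (Set.Icc 0 1) t

/-- The path is controlled only on `[0, 1]`, so the two-sided derivative in `cint` may be
meaningless at the endpoints. These form a null set, and one-sided derivatives make the integrand
continuous up to the ends. -/
theorem cint_eq_pullback (U : CoordinateCover X ι) (C : ClosedCurve A) (w : ι → ℂ → ℂ) :
    cint U C w = 1 / (24 * Real.pi * Complex.I) *
      ∑ k, ∫ t in (0 : ℝ)..1, pullback U C w k t := by
  unfold cint
  congr 1
  refine Finset.sum_congr rfl fun k _ => ?_
  rw [intervalIntegral.integral_of_le zero_le_one, intervalIntegral.integral_of_le zero_le_one,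
    MeasureTheory.integral_Ioc_eq_integral_Ioo, MeasureTheory.integral_Ioc_eq_integral_Ioo]
  refine MeasureTheory.setIntegral_congr_fun measurableSet_Ioo fun t ht => ?_
  simp only [pullback]
  rw [derivWithin_of_mem_nhds (Icc_mem_nhds ht.1 ht.2)]

/-- The curve avoids `A`, so values off `U.dom A i` are never seen. Identities between derivatives
of forms, available only on that set, therefore suffice. -/
theorem cint_congr (C : ClosedCurve A) {w v : ι → ℂ → ℂ}
    (h : ∀ i, ∀ z ∈ U.dom A i, w i z = v i z) : cint U C w = cint U C v := by
  unfold cint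
  congr 1
  refine Finset.sum_congr rfl fun k _ => intervalIntegral.integral_congr fun t ht => ?_
  rw [Set.uIcc_of_le zero_le_one] at ht
  rw [h _ _ (C.mem_dom ht (U.index_mem _))]

theorem cint_const_mul (C : ClosedCurve A) (a : ℂ) (w : ι → ℂ → ℂ) :
    cint U C (fun i z => a * w i z) = a * cint U C w := by
  unfold cint
  rw [mul_left_comm]
  congr 1
  rw [Finset.mul_sum]
  refine Finset.sum_congr rfl fun k _ => ?_
  rw [← intervalIntegral.integral_const_mul]
  simp only [mul_assoc]

variable [IsManifold 𝓘(ℂ) ω X]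

/-- The pullback of a differential to the curve can be computed in any coordinate. -/
theorem IsDifferential.pullback_eq {w : ι → ℂ → ℂ} (hw : IsDifferential U A w)
    (C : ClosedCurve A) (i : ι) {k : Fin C.num} {t : ℝ} (ht : t ∈ Set.Icc (0 : ℝ) 1)
    (hi : C.path k t ∈ (U.chart i).source) :
    pullback U C w k t = w i (U.chart i (C.path k t)) *
      derivWithin (fun s => U.chart i (C.path k s)) (Set.Icc 0 1) t := by
  set j := U.index (C.path k t) with hj
  have hjs : C.path k t ∈ (U.chart j).source := U.index_mem _
  have hov := U.mem_overlap hi hjs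
  have h1 : HasDerivWithinAt (fun s => U.chart j (C.path k s))
      (deriv (U.trans i j) (U.chart i (C.path k t)) *
        derivWithin (fun s => U.chart i (C.path k s)) (Set.Icc 0 1) t) (Set.Icc 0 1) t := by
    refine (HasDerivAt.comp_hasDerivWithinAt t (U.differentiableAt_trans hov).hasDerivAt
      (C.hasDerivWithinAt_chart i ht hi)).congr_of_eventuallyEq ?_ ?_
    · filter_upwards [C.eventually_mem_source i ht hi] with s hs
      exact (U.trans_chart j hs).symm
    · exact (U.trans_chart j hi).symm
  have h2 := hw.transform i j _ ⟨C.mem_dom ht hi, hov⟩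
  rw [pullback, ← hj, h1.derivWithin (uniqueDiffOn_Icc_zero_one t ht), ← h2,
    U.trans_chart j hi]
  ring

/-- The index chosen at `C.path k t` may jump with `t`. Near a given `t` the pullback is rewritten
in the one coordinate chosen at `t`, where continuity is visible. -/
theorem IsDifferential.continuousOn_pullback [T1Space X] {w : ι → ℂ → ℂ}
    (hw : IsDifferential U A w) (C : ClosedCurve A) (k : Fin C.num) :
    ContinuousOn (pullback U C w k) (Set.Icc 0 1) := by
  intro t ht
  set i := U.index (C.path k t) with hi
  have his : C.path k t ∈ (U.chart i).source := U.index_mem _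
  have hd := C.contDiffWithinAt_chart i ht his
  have h1 : ContinuousWithinAt
      (fun s => derivWithin (fun s => U.chart i (C.path k s)) (Set.Icc 0 1) s)
      (Set.Icc 0 1) t :=
    ((hd.fderivWithin_right (m := 0) uniqueDiffOn_Icc_zero_one (by simp) ht).continuousWithinAt).clm_apply
      continuousWithinAt_const
  have h2 : ContinuousWithinAt (fun s => w i (U.chart i (C.path k s))) (Set.Icc 0 1) t :=
    ((hw.continuousOn i).continuousAt ((U.isOpen_dom A i).mem_nhds
      (C.mem_dom ht his))).comp_continuousWithinAt (f := fun s => U.chart i (C.path k s))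
      hd.continuousWithinAt
  refine (h2.mul h1).congr_of_eventuallyEq ?_ (hw.pullback_eq C i ht his)
  filter_upwards [C.eventually_mem_source i ht his, self_mem_nhdsWithin] with s hs hs'
  exact hw.pullback_eq C i hs' hs

theorem IsDifferential.intervalIntegrable [T1Space X] {w : ι → ℂ → ℂ}
    (hw : IsDifferential U A w) (C : ClosedCurve A) (k : Fin C.num) :
    IntervalIntegrable (pullback U C w k) MeasureTheory.volume 0 1 :=
  ContinuousOn.intervalIntegrable_of_Icc zero_le_one (hw.continuousOn_pullback C k)

theorem cint_add [T1Space X] (C : ClosedCurve A) {w v : ι → ℂ → ℂ}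
    (hw : IsDifferential U A w) (hv : IsDifferential U A v) :
    cint U C (fun i z => w i z + v i z) = cint U C w + cint U C v := by
  simp only [cint_eq_pullback]
  rw [← mul_add, ← Finset.sum_add_distrib]
  congr 1
  refine Finset.sum_congr rfl fun k _ => ?_
  rw [← intervalIntegral.integral_add (hw.intervalIntegrable C k) (hv.intervalIntegrable C k)]
  simp only [pullback, add_mul]

theorem cint_lin [T1Space X] (C : ClosedCurve A) (a b : ℂ) {w v : ι → ℂ → ℂ}
    (hw : IsDifferential U A w) (hv : IsDifferential U A v) :
    cint U C (fun i z => a * w i z + b * v i z) = a * cint U C w + b * cint U C v := by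
  rw [cint_add C (hw.const_mul a) (hv.const_mul b), cint_const_mul, cint_const_mul]

/-- The integral of an exact differential over a closed curve vanishes. -/
theorem cint_exact [T1Space X] (C : ClosedCurve A) {w F : ι → ℂ → ℂ}
    (hw : IsDifferential U A w)
    (hF : ∀ i, ∀ z ∈ U.dom A i, HasDerivAt (F i) (w i z) z)
    (hinv : ∀ i j, ∀ z ∈ U.dom A i ∩ U.overlap i j, F j (U.trans i j z) = F i z) :
    cint U C w = 0 := by
  rw [cint_eq_pullback, Finset.sum_eq_zero, mul_zero]
  intro k _
  -- The local primitives agree on overlaps, so they glue to a function along the loop; `heq`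
  -- evaluates it in any coordinate, and it is a primitive of the pullback.
  set H : ℝ → ℂ := fun t =>
    F (U.index (C.path k t)) (U.chart (U.index (C.path k t)) (C.path k t)) with hH
  have heq : ∀ i, ∀ t ∈ Set.Icc (0 : ℝ) 1, C.path k t ∈ (U.chart i).source →
      H t = F i (U.chart i (C.path k t)) := by
    intro i t ht hi
    rw [← hinv i (U.index (C.path k t)) _
      ⟨C.mem_dom ht hi, U.mem_overlap hi (U.index_mem _)⟩, U.trans_chart _ hi]
  have hd : ∀ t ∈ Set.Icc (0 : ℝ) 1,
      HasDerivWithinAt H (pullback U C w k t) (Set.Icc 0 1) t := by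
    intro t ht
    have hi := U.index_mem (C.path k t)
    refine (HasDerivAt.comp_hasDerivWithinAt t (hF _ _ (C.mem_dom ht hi))
      (C.hasDerivWithinAt_chart _ ht hi)).congr_of_eventuallyEq ?_ rfl
    filter_upwards [C.eventually_mem_source _ ht hi, self_mem_nhdsWithin] with s hs hs'
    exact heq _ s hs' hs
  rw [intervalIntegral.integral_eq_sub_of_hasDerivAt_of_le zero_le_one
    (fun t ht => (hd t ht).continuousWithinAt)
    (fun t ht => (hd t (Set.Ioo_subset_Icc_self ht)).hasDerivAt (Icc_mem_nhds ht.1 ht.2))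
    (hw.intervalIntegrable C k)]
  -- `H t` depends on `t` only through the point `C.path k t`, so its values at the two ends
  -- coincide.
  simp only [hH, C.closed k, sub_self]

end Curves

/-! ### Derivatives under a coordinate change with `h' = u⁻²` -/

section Local

variable {D : Set ℂ} {h u f g : ℂ → ℂ} {z : ℂ}

theorem hasDerivAt_iteratedDeriv (hg : AnalyticAt ℂ g z) (n : ℕ) :
    HasDerivAt (iteratedDeriv n g) (iteratedDeriv (n + 1) g z) z := by
  rw [iteratedDeriv_succ, iteratedDeriv_eq_iterate]
  exact (hg.iterated_deriv n).differentiableAt.hasDerivAt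

theorem hasDerivAt_deriv (hg : AnalyticAt ℂ g z) :
    HasDerivAt (deriv g) (iteratedDeriv 2 g z) z := by
  simpa [iteratedDeriv_one] using hasDerivAt_iteratedDeriv hg 1

/-- Each derivative formula is established on a whole open set so that it can be differentiated once
more; this is the inductive step. -/
theorem deriv_eq_of_eqOn {F : ℂ → ℂ} {F' : ℂ} (hD : IsOpen D) (hf : ∀ w ∈ D, f w = F w)
    (hz : z ∈ D) (hF : HasDerivAt F F' z) : deriv f z = F' := by
  have h : f =ᶠ[nhds z] F := by
    filter_upwards [hD.mem_nhds hz] with w hw using hf w hw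
  rw [h.deriv_eq, hF.deriv]

theorem hasDerivAt_iteratedDeriv_comp (hh : ∀ z ∈ D, HasDerivAt h ((u z)⁻¹ ^ 2) z)
    (hg : AnalyticAt ℂ g (h z)) (hz : z ∈ D) (n : ℕ) :
    HasDerivAt (fun w => iteratedDeriv n g (h w))
      (iteratedDeriv (n + 1) g (h z) * (u z)⁻¹ ^ 2) z :=
  (hasDerivAt_iteratedDeriv hg n).comp z (hh z hz)

/-- The Schwarzian derivative of a coordinate change with derivative `u⁻²`. -/
theorem schwarzian_eq (hD : IsOpen D)
    (hh : ∀ z ∈ D, HasDerivAt h ((u z)⁻¹ ^ 2) z)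
    (hu : AnalyticOnNhd ℂ u D) (hu0 : ∀ z ∈ D, u z ≠ 0) (hz : z ∈ D) :
    schwarzian h z = -2 * iteratedDeriv 2 u z * (u z)⁻¹ := by
  have e1 : ∀ z ∈ D, deriv h z = (u z)⁻¹ ^ 2 := fun z hz => (hh z hz).deriv
  have e2 : ∀ z ∈ D, iteratedDeriv 2 h z = -2 * (u z)⁻¹ ^ 3 * deriv u z := by
    intro z hz
    rw [iteratedDeriv_succ, iteratedDeriv_one]
    have h0 := hu0 z hz
    refine deriv_eq_of_eqOn hD e1 hz ?_
    refine HasDerivAt.congr_deriv (((hu z hz).differentiableAt.hasDerivAt.inv h0).pow 2) ?_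
    simp only [Pi.inv_apply, Nat.reduceSub, pow_one]
    field_simp
    ring
  have e3 : iteratedDeriv 3 h z =
      6 * (u z)⁻¹ ^ 4 * deriv u z ^ 2 - 2 * (u z)⁻¹ ^ 3 * iteratedDeriv 2 u z := by
    rw [iteratedDeriv_succ]
    have h0 := hu0 z hz
    refine deriv_eq_of_eqOn hD e2 hz ?_
    refine HasDerivAt.congr_deriv (((((hu z hz).differentiableAt.hasDerivAt.inv h0).pow 3).const_mul (-2)).mul
      (hasDerivAt_deriv (hu z hz))) ?_
    simp only [Pi.inv_apply, Pi.pow_apply, Nat.reduceSub]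
    field_simp
    ring
  have h0 := hu0 z hz
  rw [schwarzian, e1 z hz, e2 z hz, e3]
  field_simp
  ring

/-- The derivatives of a form of weight `-1/2` in another coordinate. -/
theorem derivs_halfForm (hD : IsOpen D)
    (hh : ∀ z ∈ D, HasDerivAt h ((u z)⁻¹ ^ 2) z)
    (hu : AnalyticOnNhd ℂ u D) (hu0 : ∀ z ∈ D, u z ≠ 0)
    (hg : ∀ z ∈ D, AnalyticAt ℂ g (h z)) (hf : ∀ z ∈ D, f z = g (h z) * u z) (hz : z ∈ D) :
    deriv f z = deriv g (h z) * (u z)⁻¹ + g (h z) * deriv u z ∧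
    iteratedDeriv 2 f z =
      iteratedDeriv 2 g (h z) * (u z)⁻¹ ^ 3 + g (h z) * iteratedDeriv 2 u z := by
  have d := fun n z hz => hasDerivAt_iteratedDeriv_comp hh (hg z hz) hz n
  have d0 := d 0
  have d1 := d 1
  simp only [iteratedDeriv_zero, zero_add, iteratedDeriv_one, Nat.reduceAdd] at d0 d1
  have e1 : ∀ z ∈ D, deriv f z = deriv g (h z) * (u z)⁻¹ + g (h z) * deriv u z := by
    intro z hz
    have h0 := hu0 z hz
    refine deriv_eq_of_eqOn hD hf hz ?_
    refine HasDerivAt.congr_deriv ((d0 z hz).mul (hu z hz).differentiableAt.hasDerivAt) ?_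
    field_simp
  refine ⟨e1 z hz, ?_⟩
  rw [iteratedDeriv_succ, iteratedDeriv_one]
  have h0 := hu0 z hz
  refine deriv_eq_of_eqOn hD e1 hz ?_
  have du := (hu z hz).differentiableAt.hasDerivAt
  refine HasDerivAt.congr_deriv (((d1 z hz).mul (du.inv h0)).add
    ((d0 z hz).mul (hasDerivAt_deriv (hu z hz)))) ?_
  -- The two terms `g' u' u⁻²` cancel: the second derivative of a `-1/2`-form has no first-order
  -- anomaly, only `g u''`.
  simp only [Pi.inv_apply]
  field_simp
  ring

/-- The derivatives of a vector field in another coordinate. -/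
theorem derivs_vectorField (hD : IsOpen D)
    (hh : ∀ z ∈ D, HasDerivAt h ((u z)⁻¹ ^ 2) z)
    (hu : AnalyticOnNhd ℂ u D) (hu0 : ∀ z ∈ D, u z ≠ 0)
    (hg : ∀ z ∈ D, AnalyticAt ℂ g (h z)) (hf : ∀ z ∈ D, f z = g (h z) * u z ^ 2) (hz : z ∈ D) :
    deriv f z = deriv g (h z) + 2 * g (h z) * u z * deriv u z ∧
    iteratedDeriv 2 f z = iteratedDeriv 2 g (h z) * (u z)⁻¹ ^ 2
      + 2 * deriv g (h z) * (u z)⁻¹ * deriv u z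
      + 2 * g (h z) * (deriv u z ^ 2 + u z * iteratedDeriv 2 u z) ∧
    iteratedDeriv 3 f z = iteratedDeriv 3 g (h z) * (u z)⁻¹ ^ 4
      + 4 * deriv g (h z) * (u z)⁻¹ * iteratedDeriv 2 u z
      + 2 * g (h z) * (3 * deriv u z * iteratedDeriv 2 u z + u z * iteratedDeriv 3 u z) := by
  have d := fun n z hz => hasDerivAt_iteratedDeriv_comp hh (hg z hz) hz n
  have d0 := d 0
  have d1 := d 1
  have d2 := d 2
  simp only [iteratedDeriv_zero, zero_add, iteratedDeriv_one, Nat.reduceAdd] at d0 d1 d2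
  have du := fun z hz => (hu z hz).differentiableAt.hasDerivAt
  have ddu := fun z hz => hasDerivAt_deriv (hu z hz)
  have dddu := fun z hz => hasDerivAt_iteratedDeriv (hu z hz) 2
  have e1 : ∀ z ∈ D, deriv f z = deriv g (h z) + 2 * g (h z) * u z * deriv u z := by
    intro z hz
    have h0 := hu0 z hz
    refine deriv_eq_of_eqOn hD hf hz ?_
    refine HasDerivAt.congr_deriv ((d0 z hz).mul ((du z hz).pow 2)) ?_
    field_simp
    ring
  have e2 : ∀ z ∈ D, iteratedDeriv 2 f z = iteratedDeriv 2 g (h z) * (u z)⁻¹ ^ 2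
      + 2 * deriv g (h z) * (u z)⁻¹ * deriv u z
      + 2 * g (h z) * (deriv u z ^ 2 + u z * iteratedDeriv 2 u z) := by
    intro z hz
    rw [iteratedDeriv_succ, iteratedDeriv_one]
    have h0 := hu0 z hz
    refine deriv_eq_of_eqOn hD e1 hz ?_
    refine HasDerivAt.congr_deriv ((d1 z hz).add ((((d0 z hz).const_mul 2).mul (du z hz)).mul (ddu z hz))) ?_
    simp only [Pi.mul_apply]
    field_simp
    ring
  refine ⟨e1 z hz, e2 z hz, ?_⟩
  rw [iteratedDeriv_succ]
  have h0 := hu0 z hz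
  refine deriv_eq_of_eqOn hD e2 hz ?_
  refine HasDerivAt.congr_deriv ((((d2 z hz).mul (((du z hz).inv h0).pow 2)).add
    ((((d1 z hz).const_mul 2).mul ((du z hz).inv h0)).mul (ddu z hz))).add
    (((d0 z hz).const_mul 2).mul
      (((ddu z hz).pow 2).add ((du z hz).mul (dddu z hz))))) ?_
  -- The terms in `g''` and in `g' (u')²` cancel, so the anomaly of the third derivative involves
  -- only `g` and `g'`.
  simp only [Pi.pow_apply, Pi.inv_apply, Pi.mul_apply, Nat.reduceSub, pow_one]
  field_simp
  ring

end Local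

/-! ### The densities are differentials -/

section Forms

variable {X : Type*} [TopologicalSpace X] [ChartedSpace ℂ X] {ι : Type*}
  {U : CoordinateCover X ι} {L : ThetaCharacteristic U} {A : Finset X}

theorem CoordinateCover.trans_mem_dom {i j : ι} {z : ℂ} (hz : z ∈ U.dom A i ∩ U.overlap i j) :
    U.trans i j z ∈ U.dom A j := by
  refine ⟨(U.chart j).map_source hz.2.2, ?_⟩
  rw [CoordinateCover.trans, (U.chart j).left_inv hz.2.2]
  exact hz.1.2

theorem forms.analyticAt {k : ℤ} (f : forms L A k) {i : ι} {z : ℂ} (hz : z ∈ U.dom A i) :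
    AnalyticAt ℂ (f.1 i) z :=
  f.2.2.1 i z hz

variable [T1Space X]

/-- The data of a coordinate change, in terms of `u = (dz_i)^{1/2} / (dz_j)^{1/2}`. -/
theorem ThetaCharacteristic.coordinateChange (L : ThetaCharacteristic U) (A : Finset X) (i j : ι) :
    ∃ u : ℂ → ℂ, IsOpen (U.dom A i ∩ U.overlap i j) ∧
      (∀ z ∈ U.dom A i ∩ U.overlap i j, HasDerivAt (U.trans i j) ((u z)⁻¹ ^ 2) z) ∧
      AnalyticOnNhd ℂ u (U.dom A i ∩ U.overlap i j) ∧
      (∀ z ∈ U.dom A i ∩ U.overlap i j, u z ≠ 0) ∧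
      (∀ e : forms L A (-2), ∀ z ∈ U.dom A i ∩ U.overlap i j,
        e.1 i z = e.1 j (U.trans i j z) * u z ^ 2) ∧
      (∀ φ : forms L A (-1), ∀ z ∈ U.dom A i ∩ U.overlap i j,
        φ.1 i z = φ.1 j (U.trans i j z) * u z) := by
  refine ⟨fun z => (L.root i j z)⁻¹, (U.isOpen_dom A i).inter (U.isOpen_overlap i j),
    fun z hz => ?_, fun z hz => (L.analyticOnNhd i j z hz.2).inv (L.root_ne_zero i j z hz.2),
    fun z hz => inv_ne_zero (L.root_ne_zero i j z hz.2), fun e z hz => ?_, fun φ z hz => ?_⟩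
  · rw [inv_inv, L.sq_eq i j z hz.2]
    exact (U.differentiableAt_trans hz.2).hasDerivAt
  · rw [← e.2.2.2.2 i j z hz, zpow_neg, inv_pow]
    norm_cast
  · rw [← φ.2.2.2.2 i j z hz, zpow_neg_one]

/-- The differential integrated in `Φ_{C,R}(e, f)`. -/
noncomputable def evenDensity (R : ProjectiveConnection U) (e f : forms L A (-2)) : ι → ℂ → ℂ :=
  fun i z =>
    1 / 2 * (iteratedDeriv 3 (e.1 i) z * f.1 i z - e.1 i z * iteratedDeriv 3 (f.1 i) z)
      - R.toFun i z * (deriv (e.1 i) z * f.1 i z - e.1 i z * deriv (f.1 i) z)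

/-- Minus the differential integrated in `Φ_{C,R}(φ, ψ)`. -/
noncomputable def oddDensity (R : ProjectiveConnection U) (φ ψ : forms L A (-1)) : ι → ℂ → ℂ :=
  fun i z =>
    iteratedDeriv 2 (φ.1 i) z * ψ.1 i z + φ.1 i z * iteratedDeriv 2 (ψ.1 i) z
      - R.toFun i z * φ.1 i z * ψ.1 i z

theorem continuousAt_iteratedDeriv {g : ℂ → ℂ} {z : ℂ} (hg : AnalyticAt ℂ g z)
    (n : ℕ) : ContinuousAt (iteratedDeriv n g) z :=
  (hasDerivAt_iteratedDeriv hg n).continuousAt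

/-- In `1/2 (e'''f - ef''')` the anomalous terms without derivatives of `e`, `f` drop out by
antisymmetry. What remains is `2uu''(e'f - ef')`, taken in the coordinate `z_j`, and the term
`2u''/u` in the transformation of `R` cancels it. -/
theorem isDifferential_evenDensity (R : ProjectiveConnection U) (e f : forms L A (-2)) :
    IsDifferential U A (evenDensity R e f) := by
  constructor
  · intro i z hz
    have he := forms.analyticAt e hz
    have hf := forms.analyticAt f hz
    refine ContinuousAt.continuousWithinAt ?_
    exact (continuousAt_const.mul
      (((continuousAt_iteratedDeriv he 3).mul hf.continuousAt).sub
        (he.continuousAt.mul (continuousAt_iteratedDeriv hf 3)))).sub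
      ((R.analyticOnNhd i z hz.1).continuousAt.mul
        ((he.deriv.continuousAt.mul hf.continuousAt).sub
          (he.continuousAt.mul hf.deriv.continuousAt)))
  · intro i j z hz
    obtain ⟨u, hD, hh, hu, hu0, h2, -⟩ := L.coordinateChange A i j
    have hm := fun (g : forms L A (-2)) (w : ℂ) (hw : w ∈ U.dom A i ∩ U.overlap i j) =>
      forms.analyticAt g (CoordinateCover.trans_mem_dom hw)
    obtain ⟨e1, -, e3⟩ := derivs_vectorField hD hh hu hu0 (hm e) (h2 e) hz
    obtain ⟨f1, -, f3⟩ := derivs_vectorField hD hh hu hu0 (hm f) (h2 f) hz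
    have hR := R.transform i j z hz.2
    have h0 := hu0 z hz
    rw [schwarzian_eq hD hh hu hu0 hz, (hh z hz).deriv] at hR
    rw [evenDensity, evenDensity, e1, e3, f1, f3, h2 e z hz, h2 f z hz, (hh z hz).deriv,
      eq_sub_of_add_eq hR.symm]
    field_simp
    ring

/-- The anomaly of `φ''ψ + φψ''` is `2uu''φψ`, taken in the coordinate `z_j`; it is again what
`2u''/u` in the transformation of `R` removes. -/
theorem isDifferential_oddDensity (R : ProjectiveConnection U) (φ ψ : forms L A (-1)) :
    IsDifferential U A (oddDensity R φ ψ) := by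
  constructor
  · intro i z hz
    have he := forms.analyticAt φ hz
    have hf := forms.analyticAt ψ hz
    refine ContinuousAt.continuousWithinAt ?_
    exact (((continuousAt_iteratedDeriv he 2).mul hf.continuousAt).add
        (he.continuousAt.mul (continuousAt_iteratedDeriv hf 2))).sub
      (((R.analyticOnNhd i z hz.1).continuousAt.mul he.continuousAt).mul hf.continuousAt)
  · intro i j z hz
    obtain ⟨u, hD, hh, hu, hu0, -, h1⟩ := L.coordinateChange A i j
    have hm := fun (g : forms L A (-1)) (w : ℂ) (hw : w ∈ U.dom A i ∩ U.overlap i j) =>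
      forms.analyticAt g (CoordinateCover.trans_mem_dom hw)
    obtain ⟨-, e2⟩ := derivs_halfForm hD hh hu hu0 (hm φ) (h1 φ) hz
    obtain ⟨-, f2⟩ := derivs_halfForm hD hh hu hu0 (hm ψ) (h1 ψ) hz
    have hR := R.transform i j z hz.2
    have h0 := hu0 z hz
    rw [schwarzian_eq hD hh hu hu0 hz, (hh z hz).deriv] at hR
    rw [oddDensity, oddDensity, e2, f2, h1 φ z hz, h1 ψ z hz, (hh z hz).deriv,
      eq_sub_of_add_eq hR.symm]
    field_simp
    ring

/-- The pairing of the quadratic differential `R' - R` with a vector field. -/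
theorem isDifferential_connectionDifference (R R' : ProjectiveConnection U)
    (e : forms L A (-2)) :
    IsDifferential U A (fun i z => (R'.toFun i z - R.toFun i z) * e.1 i z) := by
  constructor
  · intro i z hz
    exact ContinuousAt.continuousWithinAt
      (((R'.analyticOnNhd i z hz.1).continuousAt.sub
        (R.analyticOnNhd i z hz.1).continuousAt).mul (forms.analyticAt e hz).continuousAt)
  · intro i j z hz
    obtain ⟨u, -, hh, -, hu0, h2, -⟩ := L.coordinateChange A i j
    have h0 := hu0 z hz
    have hR := R.transform i j z hz.2
    have hR' := R'.transform i j z hz.2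
    rw [(hh z hz).deriv] at hR hR'
    rw [h2 e z hz, (hh z hz).deriv]
    -- Both connections carry the same Schwarzian term, so the difference transforms as a quadratic
    -- differential.
    have : R'.toFun i z - R.toFun i z = (R'.toFun j (U.trans i j z) -
        R.toFun j (U.trans i j z)) * ((u z)⁻¹ ^ 2) ^ 2 := by
      linear_combination hR - hR'
    rw [this]
    field_simp

end Forms

/-! ### Leibniz formulas for products and Lie derivatives -/

section Local

variable {D : Set ℂ} {f g : ℂ → ℂ} {z : ℂ}

theorem derivs_mul (hD : IsOpen D) (hf : AnalyticOnNhd ℂ f D) (hg : AnalyticOnNhd ℂ g D)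
    (hz : z ∈ D) :
    deriv (fun w => f w * g w) z = deriv f z * g z + f z * deriv g z ∧
    iteratedDeriv 3 (fun w => f w * g w) z = iteratedDeriv 3 f z * g z
      + 3 * iteratedDeriv 2 f z * deriv g z + 3 * deriv f z * iteratedDeriv 2 g z
      + f z * iteratedDeriv 3 g z := by
  have f0 := fun z hz => (hf z hz).differentiableAt.hasDerivAt
  have g0 := fun z hz => (hg z hz).differentiableAt.hasDerivAt
  have f1 := fun z hz => hasDerivAt_deriv (hf z hz)
  have g1 := fun z hz => hasDerivAt_deriv (hg z hz)
  have f2 := fun z hz => hasDerivAt_iteratedDeriv (hf z hz) 2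
  have g2 := fun z hz => hasDerivAt_iteratedDeriv (hg z hz) 2
  have e1 : ∀ z ∈ D, deriv (fun w => f w * g w) z = deriv f z * g z + f z * deriv g z :=
    fun z hz => ((f0 z hz).mul (g0 z hz)).deriv
  have e2 : ∀ z ∈ D, iteratedDeriv 2 (fun w => f w * g w) z =
      iteratedDeriv 2 f z * g z + 2 * (deriv f z * deriv g z) + f z * iteratedDeriv 2 g z := by
    intro z hz
    rw [iteratedDeriv_succ, iteratedDeriv_one]
    refine deriv_eq_of_eqOn hD e1 hz (HasDerivAt.congr_deriv
      (((f1 z hz).mul (g0 z hz)).add ((f0 z hz).mul (g1 z hz))) ?_)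
    ring
  refine ⟨e1 z hz, ?_⟩
  rw [iteratedDeriv_succ]
  refine deriv_eq_of_eqOn hD e2 hz (HasDerivAt.congr_deriv
    ((((f2 z hz).mul (g0 z hz)).add (((f1 z hz).mul (g1 z hz)).const_mul 2)).add
      ((f0 z hz).mul (g2 z hz))) ?_)
  ring

/-- The constant `c` stands for the weight: `-1` for vector fields, `-1/2` for the odd part. -/
theorem derivs_lieDer (c : ℂ) (hD : IsOpen D) (hf : AnalyticOnNhd ℂ f D)
    (hg : AnalyticOnNhd ℂ g D) (hz : z ∈ D) :
    deriv (fun w => f w * deriv g w + c * g w * deriv f w) z =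
      f z * iteratedDeriv 2 g z + (1 + c) * (deriv f z * deriv g z)
        + c * (g z * iteratedDeriv 2 f z) ∧
    iteratedDeriv 2 (fun w => f w * deriv g w + c * g w * deriv f w) z =
      f z * iteratedDeriv 3 g z + (2 + c) * (deriv f z * iteratedDeriv 2 g z)
        + (1 + 2 * c) * (iteratedDeriv 2 f z * deriv g z) + c * (g z * iteratedDeriv 3 f z) ∧
    iteratedDeriv 3 (fun w => f w * deriv g w + c * g w * deriv f w) z =
      f z * iteratedDeriv 4 g z + (3 + c) * (deriv f z * iteratedDeriv 3 g z)
        + (3 + 3 * c) * (iteratedDeriv 2 f z * iteratedDeriv 2 g z)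
        + (1 + 3 * c) * (iteratedDeriv 3 f z * deriv g z) + c * (g z * iteratedDeriv 4 f z) := by
  have f0 := fun z hz => (hf z hz).differentiableAt.hasDerivAt
  have g0 := fun z hz => (hg z hz).differentiableAt.hasDerivAt
  have f1 := fun z hz => hasDerivAt_deriv (hf z hz)
  have g1 := fun z hz => hasDerivAt_deriv (hg z hz)
  have f2 := fun z hz => hasDerivAt_iteratedDeriv (hf z hz) 2
  have g2 := fun z hz => hasDerivAt_iteratedDeriv (hg z hz) 2
  have f3 := fun z hz => hasDerivAt_iteratedDeriv (hf z hz) 3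
  have g3 := fun z hz => hasDerivAt_iteratedDeriv (hg z hz) 3
  have e1 : ∀ z ∈ D, deriv (fun w => f w * deriv g w + c * g w * deriv f w) z =
      f z * iteratedDeriv 2 g z + (1 + c) * (deriv f z * deriv g z)
        + c * (g z * iteratedDeriv 2 f z) := by
    intro z hz
    refine deriv_eq_of_eqOn hD (fun _ _ => rfl) hz (HasDerivAt.congr_deriv
      (((f0 z hz).mul (g1 z hz)).add (((g0 z hz).const_mul c).mul (f1 z hz))) ?_)
    ring
  have e2 : ∀ z ∈ D, iteratedDeriv 2 (fun w => f w * deriv g w + c * g w * deriv f w) z =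
      f z * iteratedDeriv 3 g z + (2 + c) * (deriv f z * iteratedDeriv 2 g z)
        + (1 + 2 * c) * (iteratedDeriv 2 f z * deriv g z) + c * (g z * iteratedDeriv 3 f z) := by
    intro z hz
    rw [iteratedDeriv_succ, iteratedDeriv_one]
    refine deriv_eq_of_eqOn hD e1 hz (HasDerivAt.congr_deriv
      ((((f0 z hz).mul (g2 z hz)).add (((f1 z hz).mul (g1 z hz)).const_mul (1 + c))).add
        (((g0 z hz).mul (f2 z hz)).const_mul c)) ?_)
    ring
  refine ⟨e1 z hz, e2 z hz, ?_⟩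
  rw [iteratedDeriv_succ]
  refine deriv_eq_of_eqOn hD e2 hz (HasDerivAt.congr_deriv
    (((((f0 z hz).mul (g3 z hz)).add (((f1 z hz).mul (g2 z hz)).const_mul (2 + c))).add
      (((f2 z hz).mul (g1 z hz)).const_mul (1 + 2 * c))).add
        (((g0 z hz).mul (f3 z hz)).const_mul c)) ?_)
  ring

end Local

/-! ### The Jacobi sums are exact -/

section Cocycle

variable {X : Type*} [TopologicalSpace X] [T1Space X] [ChartedSpace ℂ X] [IsManifold 𝓘(ℂ) ω X]
  {ι : Type*} {U : CoordinateCover X ι} {L : ThetaCharacteristic U} {A : Finset X}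

/-- Let `W` be the Wronskian of `e`, `f`, `g`. The cyclic sum of `e'''[f,g]` is `W'` and that of
`e[f,g]'''` is `2W'`, while the terms with `R` cancel. The integrand is thus `-1/2 W'`. -/
theorem cint_evenDensity_jacobi (C : ClosedCurve A) (R : ProjectiveConnection U)
    (e f g : forms L A (-2)) :
    cint U C (evenDensity R e (lieDer f g)) + cint U C (evenDensity R f (lieDer g e)) +
      cint U C (evenDensity R g (lieDer e f)) = 0 := by
  have d1 := isDifferential_evenDensity R e (lieDer f g)
  have d2 := isDifferential_evenDensity R f (lieDer g e)
  have d3 := isDifferential_evenDensity R g (lieDer e f)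
  rw [← cint_add C d1 d2, ← cint_add C (d1.add d2) d3]
  refine cint_exact C (F := fun i z => -(1 / 2) *
    (e.1 i z * (deriv (f.1 i) z * iteratedDeriv 2 (g.1 i) z
        - deriv (g.1 i) z * iteratedDeriv 2 (f.1 i) z)
      + f.1 i z * (deriv (g.1 i) z * iteratedDeriv 2 (e.1 i) z
        - deriv (e.1 i) z * iteratedDeriv 2 (g.1 i) z)
      + g.1 i z * (deriv (e.1 i) z * iteratedDeriv 2 (f.1 i) z
        - deriv (f.1 i) z * iteratedDeriv 2 (e.1 i) z))) ((d1.add d2).add d3) ?_ ?_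
  · intro i z hz
    have hD := U.isOpen_dom A i
    have han := fun (s : forms L A (-2)) w (hw : w ∈ U.dom A i) => forms.analyticAt s hw
    have h0 := fun (s : forms L A (-2)) => (han s z hz).differentiableAt.hasDerivAt
    have h1 := fun (s : forms L A (-2)) => hasDerivAt_deriv (han s z hz)
    have h2 := fun (s : forms L A (-2)) => hasDerivAt_iteratedDeriv (han s z hz) 2
    have hl := fun (s t : forms L A (-2)) =>
      derivs_lieDer (((-2 : ℤ) : ℂ) / 2) hD (han s) (han t) hz
    refine HasDerivAt.congr_deriv (((((h0 e).mul (((h1 f).mul (h2 g)).sub ((h1 g).mul (h2 f)))).add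
      ((h0 f).mul (((h1 g).mul (h2 e)).sub ((h1 e).mul (h2 g))))).add
      ((h0 g).mul (((h1 e).mul (h2 f)).sub ((h1 f).mul (h2 e))))).const_mul (-(1 / 2))) ?_
    simp only [evenDensity, lieDer, (hl f g).1, (hl g e).1, (hl e f).1, (hl f g).2.2,
      (hl g e).2.2, (hl e f).2.2, Pi.mul_apply, Pi.sub_apply]
    push_cast
    ring
  -- The Wronskian of three forms of weight `-1` has weight `-3 + 0 + 1 + 2 = 0`, so it does not
  -- depend on the coordinate.
  · intro i j z hz
    obtain ⟨u, hD, hh, hu, hu0, hw, -⟩ := L.coordinateChange A i j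
    have hs := fun (s : forms L A (-2)) => derivs_vectorField hD hh hu hu0
      (fun w hw => forms.analyticAt s (CoordinateCover.trans_mem_dom hw)) (hw s) hz
    have h0 := hu0 z hz
    simp only [(hs e).1, (hs f).1, (hs g).1, (hs e).2.1, (hs f).2.1, (hs g).2.1,
      hw e z hz, hw f z hz, hw g z hz]
    field_simp
    ring

/-- This is the cocycle condition on `(e, φ, ψ)`; all signs are positive because the minus sign in
front of the odd part of `Φ` meets those of `[ψ, e] = -e.ψ` and of the super sign rule. The terms
with `R` cancel pointwise, and the primitive comes from integrating the rest by parts. -/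
theorem cint_mixed_jacobi (C : ClosedCurve A) (R : ProjectiveConnection U)
    (e : forms L A (-2)) (φ ψ : forms L A (-1)) :
    cint U C (evenDensity R e (mulForm (by norm_num) φ ψ)) +
      cint U C (oddDensity R φ (lieDer e ψ)) + cint U C (oddDensity R ψ (lieDer e φ)) = 0 := by
  have d1 := isDifferential_evenDensity R e (mulForm (by norm_num) φ ψ)
  have d2 := isDifferential_oddDensity R φ (lieDer e ψ)
  have d3 := isDifferential_oddDensity R ψ (lieDer e φ)
  rw [← cint_add C d1 d2, ← cint_add C (d1.add d2) d3]
  refine cint_exact C (F := fun i z =>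
    1 / 2 * (deriv (e.1 i) z * (deriv (φ.1 i) z * ψ.1 i z + φ.1 i z * deriv (ψ.1 i) z)
      - iteratedDeriv 2 (e.1 i) z * (φ.1 i z * ψ.1 i z)
      + e.1 i z * (iteratedDeriv 2 (φ.1 i) z * ψ.1 i z + φ.1 i z * iteratedDeriv 2 (ψ.1 i) z))
      - e.1 i z * (deriv (φ.1 i) z * deriv (ψ.1 i) z)) ((d1.add d2).add d3) ?_ ?_
  · intro i z hz
    have hD := U.isOpen_dom A i
    have he := fun w (hw : w ∈ U.dom A i) => forms.analyticAt e hw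
    have han := fun (s : forms L A (-1)) w (hw : w ∈ U.dom A i) => forms.analyticAt s hw
    have e0 := (he z hz).differentiableAt.hasDerivAt
    have e1 := hasDerivAt_deriv (he z hz)
    have e2 := hasDerivAt_iteratedDeriv (he z hz) 2
    have h0 := fun (s : forms L A (-1)) => (han s z hz).differentiableAt.hasDerivAt
    have h1 := fun (s : forms L A (-1)) => hasDerivAt_deriv (han s z hz)
    have h2 := fun (s : forms L A (-1)) => hasDerivAt_iteratedDeriv (han s z hz) 2
    have hl := fun (t : forms L A (-1)) =>
      derivs_lieDer (((-1 : ℤ) : ℂ) / 2) hD he (han t) hz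
    have hm := derivs_mul hD (han φ) (han ψ) hz
    refine HasDerivAt.congr_deriv
      (((((e1.mul (((h1 φ).mul (h0 ψ)).add ((h0 φ).mul (h1 ψ)))).sub
        (e2.mul ((h0 φ).mul (h0 ψ)))).add
        (e0.mul (((h2 φ).mul (h0 ψ)).add ((h0 φ).mul (h2 ψ))))).const_mul (1 / 2)).sub
        (e0.mul ((h1 φ).mul (h1 ψ)))) ?_
    simp only [evenDensity, oddDensity, lieDer, mulForm, hm.1, hm.2, (hl φ).2.1, (hl ψ).2.1,
      Pi.mul_apply, Pi.add_apply]
    push_cast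
    ring
  -- The weight is `-1 - 1/2 - 1/2 + 2 = 0`, and the two `u''` terms, from `e''φψ` and from `e(φ''ψ
  -- + φψ'')`, cancel.
  · intro i j z hz
    obtain ⟨u, hD, hh, hu, hu0, hw, hv⟩ := L.coordinateChange A i j
    have he := derivs_vectorField hD hh hu hu0
      (fun w hw => forms.analyticAt e (CoordinateCover.trans_mem_dom hw)) (hw e) hz
    have hs := fun (s : forms L A (-1)) => derivs_halfForm hD hh hu hu0
      (fun w hw => forms.analyticAt s (CoordinateCover.trans_mem_dom hw)) (hv s) hz
    have h0 := hu0 z hz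
    simp only [he.1, he.2.1, (hs φ).1, (hs ψ).1, (hs φ).2, (hs ψ).2,
      hw e z hz, hv φ z hz, hv ψ z hz]
    field_simp
    ring

end Cocycle

/-! ### Bilinearity, the cocycle conditions and the coboundary -/

section Algebra

variable {X : Type*} [TopologicalSpace X] [ChartedSpace ℂ X]
  {ι : Type*} {U : CoordinateCover X ι} {L : ThetaCharacteristic U} {A : Finset X}

theorem iteratedDeriv_forms_lin {k : ℤ} (n : ℕ) (a b : ℂ) (f g : forms L A k) {i : ι} {z : ℂ}
    (hz : z ∈ U.dom A i) :
    iteratedDeriv n ((a • f + b • g).1 i) z =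
      a * iteratedDeriv n (f.1 i) z + b * iteratedDeriv n (g.1 i) z := by
  have hf := (forms.analyticAt f hz).contDiffAt (n := n)
  have hg := (forms.analyticAt g hz).contDiffAt (n := n)
  have h := iteratedDeriv_add (contDiffAt_const.mul hf) (contDiffAt_const.mul hg)
    (f := fun w => a * f.1 i w) (g := fun w => b * g.1 i w)
  rw [iteratedDeriv_const_mul a hf, iteratedDeriv_const_mul b hg] at h
  exact h

theorem deriv_forms_lin {k : ℤ} (a b : ℂ) (f g : forms L A k) {i : ι} {z : ℂ}
    (hz : z ∈ U.dom A i) :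
    deriv ((a • f + b • g).1 i) z = a * deriv (f.1 i) z + b * deriv (g.1 i) z := by
  simpa only [iteratedDeriv_one] using iteratedDeriv_forms_lin 1 a b f g hz

theorem forms_lin_apply {k : ℤ} (a b : ℂ) (f g : forms L A k) (i : ι) (z : ℂ) :
    (a • f + b • g).1 i z = a * f.1 i z + b * g.1 i z :=
  rfl

theorem evenDensity_lin (R : ProjectiveConnection U) (a b : ℂ) (e f g : forms L A (-2))
    {i : ι} {z : ℂ} (hz : z ∈ U.dom A i) :
    evenDensity R e (a • f + b • g) i z =
      a * evenDensity R e f i z + b * evenDensity R e g i z := by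
  simp only [evenDensity, iteratedDeriv_forms_lin _ a b f g hz, deriv_forms_lin a b f g hz,
    forms_lin_apply]
  ring

theorem oddDensity_lin (R : ProjectiveConnection U) (a b : ℂ) (e f g : forms L A (-1))
    {i : ι} {z : ℂ} (hz : z ∈ U.dom A i) :
    oddDensity R e (a • f + b • g) i z =
      a * oddDensity R e f i z + b * oddDensity R e g i z := by
  simp only [oddDensity, iteratedDeriv_forms_lin _ a b f g hz, forms_lin_apply]
  ring

/-- Besides giving antisymmetry, this transfers linearity from the second argument to the first. -/
theorem cint_evenDensity_swap (C : ClosedCurve A) (R : ProjectiveConnection U)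
    (e f : forms L A (-2)) :
    cint U C (evenDensity R f e) = -cint U C (evenDensity R e f) := by
  rw [← neg_one_mul, ← cint_const_mul]
  refine cint_congr C fun i z _ => ?_
  simp only [evenDensity]
  ring

theorem cint_oddDensity_swap (C : ClosedCurve A) (R : ProjectiveConnection U)
    (φ ψ : forms L A (-1)) :
    cint U C (oddDensity R ψ φ) = cint U C (oddDensity R φ ψ) := by
  refine cint_congr C fun i z _ => ?_
  simp only [oddDensity]
  ring

theorem mulForm_zero {k l m : ℤ} (hm : k + l = m) (s : forms L A k) :
    mulForm hm s (0 : forms L A l) = 0 := by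
  ext i z
  simp [mulForm]

theorem zero_mulForm {k l m : ℤ} (hm : k + l = m) (t : forms L A l) :
    mulForm hm (0 : forms L A k) t = 0 := by
  ext i z
  simp [mulForm]

variable [T1Space X]

theorem superCocycle_eq (C : ClosedCurve A) (R : ProjectiveConnection U) (x y : Super L A) :
    superCocycle C R x y =
      cint U C (evenDensity R x.1 y.1) - cint U C (oddDensity R x.2 y.2) :=
  rfl

theorem lieDer_zero {k : ℤ} (e : forms L A (-2)) : lieDer e (0 : forms L A k) = 0 := by
  ext i z
  have h : ((0 : forms L A k).1 i) = 0 := rfl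
  simp [lieDer]

theorem zero_lieDer {k : ℤ} (f : forms L A k) : lieDer (0 : forms L A (-2)) f = 0 := by
  ext i z
  simp [lieDer]

variable [IsManifold 𝓘(ℂ) ω X]

theorem cint_evenDensity_lin (C : ClosedCurve A) (R : ProjectiveConnection U) (a b : ℂ)
    (e f g : forms L A (-2)) :
    cint U C (evenDensity R e (a • f + b • g)) =
      a * cint U C (evenDensity R e f) + b * cint U C (evenDensity R e g) := by
  rw [← cint_lin C a b (isDifferential_evenDensity R e f) (isDifferential_evenDensity R e g)]
  exact cint_congr C fun i z hz => evenDensity_lin R a b e f g hz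

theorem cint_oddDensity_lin (C : ClosedCurve A) (R : ProjectiveConnection U) (a b : ℂ)
    (e f g : forms L A (-1)) :
    cint U C (oddDensity R e (a • f + b • g)) =
      a * cint U C (oddDensity R e f) + b * cint U C (oddDensity R e g) := by
  rw [← cint_lin C a b (isDifferential_oddDensity R e f) (isDifferential_oddDensity R e g)]
  exact cint_congr C fun i z hz => oddDensity_lin R a b e f g hz

theorem cint_evenDensity_zero (C : ClosedCurve A) (R : ProjectiveConnection U)
    (e : forms L A (-2)) : cint U C (evenDensity R e 0) = 0 := by
  simpa using cint_evenDensity_lin C R 0 0 e 0 0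

theorem cint_oddDensity_zero (C : ClosedCurve A) (R : ProjectiveConnection U)
    (φ : forms L A (-1)) : cint U C (oddDensity R φ 0) = 0 := by
  simpa using cint_oddDensity_lin C R 0 0 φ 0 0

theorem cint_zero_evenDensity (C : ClosedCurve A) (R : ProjectiveConnection U)
    (e : forms L A (-2)) : cint U C (evenDensity R 0 e) = 0 := by
  rw [cint_evenDensity_swap, cint_evenDensity_zero, neg_zero]

theorem cint_zero_oddDensity (C : ClosedCurve A) (R : ProjectiveConnection U)
    (φ : forms L A (-1)) : cint U C (oddDensity R 0 φ) = 0 := by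
  rw [cint_oddDensity_swap, cint_oddDensity_zero]

theorem cint_oddDensity_neg (C : ClosedCurve A) (R : ProjectiveConnection U)
    (φ ψ : forms L A (-1)) :
    cint U C (oddDensity R φ (-ψ)) = -cint U C (oddDensity R φ ψ) := by
  have h := cint_oddDensity_lin C R (-1) 0 φ ψ 0
  have hψ : (-1 : ℂ) • ψ + (0 : ℂ) • (0 : forms L A (-1)) = -ψ := by module
  rw [hψ] at h
  linear_combination h

theorem superCocycle_lin_right (C : ClosedCurve A) (R : ProjectiveConnection U) (a b : ℂ)
    (x y z : Super L A) :
    superCocycle C R x (a • y + b • z) =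
      a * superCocycle C R x y + b * superCocycle C R x z := by
  simp only [superCocycle_eq, Prod.fst_add, Prod.snd_add, Prod.smul_fst, Prod.smul_snd,
    cint_evenDensity_lin, cint_oddDensity_lin]
  ring

theorem superCocycle_lin_left (C : ClosedCurve A) (R : ProjectiveConnection U) (a b : ℂ)
    (x y z : Super L A) :
    superCocycle C R (a • y + b • z) x =
      a * superCocycle C R y x + b * superCocycle C R z x := by
  simp only [superCocycle_eq, Prod.fst_add, Prod.snd_add, Prod.smul_fst, Prod.smul_snd]
  rw [cint_evenDensity_swap C R x.1 (a • y.1 + b • z.1), cint_evenDensity_swap C R x.1 y.1,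
    cint_evenDensity_swap C R x.1 z.1, cint_oddDensity_swap C R x.2 (a • y.2 + b • z.2),
    cint_oddDensity_swap C R x.2 y.2, cint_oddDensity_swap C R x.2 z.2,
    cint_evenDensity_lin, cint_oddDensity_lin]
  ring

theorem superCocycle_mem_evenCocycles (C : ClosedCurve A) (R : ProjectiveConnection U) :
    (superCocycle C R : Super L A → Super L A → ℂ) ∈ evenCocycles L A := by
  refine ⟨fun x => ⟨fun y z => ?_, fun a y => ?_⟩, fun y => ⟨fun x z => ?_, fun a x => ?_⟩,
    ?_, ?_, ?_⟩
  · simpa using superCocycle_lin_right C R 1 1 x y z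
  · simpa using superCocycle_lin_right C R a 0 x y 0
  · simpa using superCocycle_lin_left C R 1 1 y x z
  · simpa using superCocycle_lin_left C R a 0 y x 0
  · rintro ⟨e, φ⟩ ⟨f, ψ⟩ (rfl : φ = 0) (rfl : f = 0)
    simp [superCocycle_eq, cint_evenDensity_zero, cint_oddDensity_zero, cint_zero_evenDensity,
      cint_zero_oddDensity]
  · rintro p q ⟨e, φ⟩ ⟨f, ψ⟩ hx hy
    have h1 := cint_evenDensity_swap C R e f
    have h2 := cint_oddDensity_swap C R φ ψ
    fin_cases p <;> fin_cases q <;> simp [HasParity] at hx hy <;> subst hx hy <;>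
      simp [superCocycle_eq, sgn, cint_evenDensity_zero, cint_oddDensity_zero,
        cint_zero_evenDensity, cint_zero_oddDensity] <;>
      first
        | linear_combination h1
        | linear_combination -h2
  · rintro p q r ⟨e, φ⟩ ⟨f, ψ⟩ ⟨g, χ⟩ hx hy hz
    -- `h0` serves three even arguments, and `h1`, `h2`, `h3` the three positions of a single even
    -- argument among two odd ones. With one or three odd arguments every term pairs opposite
    -- parities and vanishes.
    have h0 := cint_evenDensity_jacobi C R e f g
    have h1 := cint_mixed_jacobi C R e ψ χ
    have h2 := cint_mixed_jacobi C R f χ φ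
    have h3 := cint_mixed_jacobi C R g φ ψ
    fin_cases p <;> fin_cases q <;> fin_cases r <;> simp [HasParity] at hx hy hz <;>
      subst hx hy hz <;>
      simp [superCocycle_eq, superBracket, sgn, lieDer_zero, zero_lieDer, mulForm_zero,
        zero_mulForm, cint_evenDensity_zero, cint_oddDensity_zero, cint_zero_evenDensity,
        cint_zero_oddDensity, cint_oddDensity_neg] <;>
      first
        | exact h0
        | linear_combination h1
        | linear_combination h2
        | linear_combination h3

/-- The linear form `κ_C`. -/
noncomputable def connectionDifferenceForm (L : ThetaCharacteristic U) (C : ClosedCurve A)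
    (R R' : ProjectiveConnection U) : Super L A →ₗ[ℂ] ℂ where
  toFun x := cint U C (fun i z => (R'.toFun i z - R.toFun i z) * x.1.1 i z)
  map_add' x y := by
    rw [← cint_add C (isDifferential_connectionDifference R R' x.1)
      (isDifferential_connectionDifference R R' y.1)]
    exact cint_congr C fun i z _ => mul_add _ _ _
  map_smul' a x := by
    rw [RingHom.id_apply, smul_eq_mul, ← cint_const_mul]
    exact cint_congr C fun i z _ => mul_left_comm _ _ _

/-- The identity holds already between integrands: derivatives of order two and three do not involve
the connection and cancel, and both remaining terms are `R' - R` times a component of the even part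
of `[x, y]`. -/
theorem superCocycle_sub (C : ClosedCurve A) (R R' : ProjectiveConnection U) :
    (superCocycle C R' - superCocycle C R : Super L A → Super L A → ℂ) =
      coboundary (connectionDifferenceForm L C R R') := by
  funext x y
  have h := cint_lin C 1 (-1)
    ((isDifferential_evenDensity R' x.1 y.1).add
      ((isDifferential_oddDensity R' x.2 y.2).const_mul (-1)))
    ((isDifferential_evenDensity R x.1 y.1).add
      ((isDifferential_oddDensity R x.2 y.2).const_mul (-1)))
  rw [cint_add C (isDifferential_evenDensity R' x.1 y.1)
      ((isDifferential_oddDensity R' x.2 y.2).const_mul (-1)),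
    cint_add C (isDifferential_evenDensity R x.1 y.1)
      ((isDifferential_oddDensity R x.2 y.2).const_mul (-1)),
    cint_const_mul, cint_const_mul] at h
  have hκ : coboundary (connectionDifferenceForm L C R R') x y =
      cint U C (fun i z => (R'.toFun i z - R.toFun i z) *
        (x.1.1 i z * deriv (y.1.1 i) z + ((-2 : ℤ) / 2 : ℂ) * y.1.1 i z * deriv (x.1.1 i) z +
          x.2.1 i z * y.2.1 i z)) := rfl
  rw [Pi.sub_apply, Pi.sub_apply, superCocycle_eq, superCocycle_eq, hκ]
  have hpt := cint_congr C (U := U) (w := fun i z => 1 * (evenDensity R' x.1 y.1 i z +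
      -1 * oddDensity R' x.2 y.2 i z) + -1 * (evenDensity R x.1 y.1 i z +
      -1 * oddDensity R x.2 y.2 i z))
    (v := fun i z => (R'.toFun i z - R.toFun i z) *
      (x.1.1 i z * deriv (y.1.1 i) z + ((-2 : ℤ) / 2 : ℂ) * y.1.1 i z * deriv (x.1.1 i) z +
        x.2.1 i z * y.2.1 i z)) fun i z _ => by
    simp only [evenDensity, oddDensity]
    push_cast
    ring
  linear_combination hpt - h

end Algebra
end KN

theorem mainTheorem6 {X : Type*} [TopologicalSpace X] [T2Space X] [CompactSpace X]
    [ConnectedSpace X] [ChartedSpace ℂ X] [IsManifold 𝓘(ℂ) ω X]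
    (A : Finset X) {ι : Type*} (U : KN.CoordinateCover X ι) (L : KN.ThetaCharacteristic U)
    (C : KN.ClosedCurve A) (R R' : KN.ProjectiveConnection U) :
    ∃ κ : KN.Super L A →ₗ[ℂ] ℂ,
      (∀ e φ, κ (e, φ) = KN.cint U C (fun i z => (R'.toFun i z - R.toFun i z) * e.1 i z)) ∧
      (KN.superCocycle C R' - KN.superCocycle C R : KN.Super L A → KN.Super L A → ℂ) =
        KN.coboundary κ ∧
      ∃ (h : KN.superCocycle C R ∈ KN.evenCocycles L A)
        (h' : KN.superCocycle C R' ∈ KN.evenCocycles L A),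
        (Submodule.Quotient.mk ⟨KN.superCocycle C R', h'⟩ : KN.EvenH2 L A) =
          Submodule.Quotient.mk ⟨KN.superCocycle C R, h⟩ := by
  refine ⟨KN.connectionDifferenceForm L C R R', fun _ _ => rfl, KN.superCocycle_sub C R R',
    KN.superCocycle_mem_evenCocycles C R, KN.superCocycle_mem_evenCocycles C R', ?_⟩
  rw [Submodule.Quotient.eq]
  -- The form depends only on the even component, so its value at `(0, φ)` is by definition its
  -- value at `0`.
  exact Submodule.mem_comap.2 ⟨KN.connectionDifferenceForm L C R R',
    fun _ => (KN.connectionDifferenceForm L C R R').map_zero, KN.superCocycle_sub C R R'⟩
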